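/- Let $p\ge 0$ be an integer, let $\mathbf{F}_{2p}=\langle a_1,\dots,a_p,b_1,\dots,b_p\rangle$ be the free group of rank $2p$, and let $C=\langle\kappa\rangle$ be the cyclic subgroup generated by the product of commutators $\kappa=\prod_{i=1}^{p}[a_i,b_i]$, where $[a,b]=aba^{-1}b^{-1}$. Then $C$ is a measure free-factor of $\mathbf{F}_{2p}$. That is, there exist a standard Borel probability space $(X,\mu)$, an essentially free measure-preserving Borel action of $\mathbf{F}_{2p}$ on $(X,\mu)$, with orbit equivalence relation $\mathcal{R}$, and a Borel equivalence relation $\mathcal{S}\subseteq\mathcal{R}$ on $X$ such that $\mathcal{R}=\mathcal{R}_C*\mathcal{S}$, where $\mathcal{R}_C$ is the orbit equivalence relation of the restriction of the action to $C$. Here $\mathcal{R}=\mathcal{R}_C*\mathcal{S}$ means that, up to a $\mu$-null set: (i) $\mathcal{R}$ is the smallest equivalence relation containing $\mathcal{R}_C$ and $\mathcal{S}$; and (ii) for every $n\ge 1$ and every tuple $(x_j)_{j\in\mathbb{Z}/2n\mathbb{Z}}$ of points of $X$ such that $(x_{2i-1},x_{2i})\in\mathcal{R}_C$ and $(x_{2i},x_{2i+1})\in\mathcal{S}$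 for all $i$, there is a $j$ with $x_j=x_{j+1}$. -/

import Mathlib

open MeasureTheory

/-- An action of `Γ` on the measure space `(X, μ)` is (essentially) free if almost every point has
trivial stabilizer. -/
def IsEssentiallyFree (Γ : Type*) {X : Type*} [Group Γ] [MulAction Γ X] [MeasurableSpace X]
    (μ : Measure X) : Prop :=
  ∀ᵐ x ∂μ, MulAction.stabilizer Γ x = ⊥

/-- The equivalence relation `R` on `(X, μ)` splits as the free product `R = R₁ * R₂` of its
subrelations `R₁` and `R₂`: up to a null set, `R` is generated by `R₁` and `R₂`, and every
closed `2n`-tuple whose consecutive points are alternately `R₁`- and `R₂`-equivalent has two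
consecutive points that are equal. (`R₁ ⊔ R₂` is the smallest equivalence relation containing
`R₁` and `R₂`.) -/
structure IsFreeProductRel {X : Type*} [MeasurableSpace X] (μ : Measure X)
    (R R₁ R₂ : Setoid X) : Prop where
  left_le : R₁ ≤ R
  right_le : R₂ ≤ R
  generates : ∀ᵐ x ∂μ, ∀ y, R x y → (R₁ ⊔ R₂) x y
  no_reduced_cycle : ∀ᵐ x₀ ∂μ, ∀ n : ℕ, 1 ≤ n → ∀ x : ZMod (2 * n) → X, x 0 = x₀ →
    (∀ i : ZMod (2 * n), R₁ (x (2 * i - 1)) (x (2 * i)) ∧ R₂ (x (2 * i)) (x (2 * i + 1))) →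
      ∃ j : ZMod (2 * n), x j = x (j + 1)

/-- `Λ` is a measure free-factor of the countable group `Γ`: for some (essentially) free
probability measure preserving action of `Γ` on a standard Borel probability space, there is a
Borel subrelation `S` of the orbit relation of `Γ` such that the orbit relation of `Γ` is the free
product of the orbit relation of `Λ` and `S`. (The classes of such an `S` are countable and `S`
preserves `μ`, since this holds for the orbit relation of `Γ`.) -/
def IsMeasureFreeFactor {Γ : Type*} [Group Γ] [Countable Γ] (Λ : Subgroup Γ) : Prop :=
  ∃ (X : Type) (_ : MeasurableSpace X) (_ : StandardBorelSpace X)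
    (μ : Measure X) (_ : IsProbabilityMeasure μ)
    (_ : MulAction Γ X) (_ : MeasurableConstSMul Γ X) (_ : SMulInvariantMeasure Γ X μ),
    IsEssentiallyFree Γ μ ∧
    ∃ S : Setoid X, MeasurableSet {q : X × X | S q.1 q.2} ∧
      IsFreeProductRel μ (MulAction.orbitRel Γ X) (MulAction.orbitRel Λ X) S

/-- The element `κ = [a₁, b₁] [a₂, b₂] ⋯ [a_p, b_p]` of the free group on
`a₁, …, a_p, b₁, …, b_p`, where `a_i` and `b_i` are the generators indexed by `Sum.inl i` and
`Sum.inr i`, and `[a, b] = a b a⁻¹ b⁻¹`. -/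
def prodCommutators (p : ℕ) : FreeGroup (Fin p ⊕ Fin p) :=
  let a : Fin p → FreeGroup (Fin p ⊕ Fin p) := fun i => FreeGroup.of (Sum.inl i)
  let b : Fin p → FreeGroup (Fin p ⊕ Fin p) := fun i => FreeGroup.of (Sum.inr i)
  (List.ofFn fun i : Fin p => a i * b i * (a i)⁻¹ * (b i)⁻¹).prod

/-!
In the Cayley tree of a free group, delete one of the edges `u — a u` and `u — b u` at each vertex
`u`, and add the edges `u — κ u`, where `κ = [a, b] w` and `w` does not involve `a` and `b`. Up to
`w`, such an edge closes the broken line `b a u, a u, u, b u, a b u`. If along a rank function each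
deleted edge can be recovered from the new edge and from deleted edges of smaller rank, then the
result is again a tree, so that the relation generated by `κ` and the kept edges is their free
product. A choice of edges and a rank come from independent coin tosses indexed by `ℤ`, on which
`a` acts by turning over the coin at `0` and `b` by shifting: the coin at `0` selects the edge, and
the rank is read off from the run of heads next to it, which is almost surely finite. The Bernoulli
action of the group is only there to make the action essentially free.
-/

section AlternatingCycles

open MulAction
open Monoid.CoprodI (Word)

variable {Λ X : Type*} [Group Λ] [MulAction Λ X]

/-- The free product of copies of `Λ` indexed by the `Λ`-orbits of `X`. It is the universal target
for functions detecting alternating cycles: each orbit moves along its own free factor. -/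
abbrev OrbitCoprod (Λ X : Type*) [Group Λ] [MulAction Λ X] : Type _ :=
  Monoid.CoprodI fun _ : orbitRel.Quotient Λ X => Λ

/-- The inclusion of `Λ` into `OrbitCoprod Λ X` as the free factor of the orbit of `x`. -/
def OrbitCoprod.of (x : X) : Λ →* OrbitCoprod Λ X :=
  Monoid.CoprodI.of (M := fun _ => Λ) (i := Quotient.mk (orbitRel Λ X) x)

theorem OrbitCoprod.of_injective (x : X) : Function.Injective (of x : Λ → OrbitCoprod Λ X) :=
  Monoid.CoprodI.of_injective _

theorem OrbitCoprod.of_smul (g : Λ) (x : X) :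
    (of (g • x) : Λ →* OrbitCoprod Λ X) = of x :=
  congrArg (fun c => Monoid.CoprodI.of (M := fun _ : orbitRel.Quotient Λ X => Λ) (i := c))
    (Quotient.sound (mem_orbit x g))

/-- At the points `x` of `s`, the function `f` turns the action of `g : Λ` into left multiplication
by the copy of `g` in the free factor of the orbit of `x`. -/
def OrbitwiseEquivariantOn (f : X → OrbitCoprod Λ X) (s : Set X) : Prop :=
  ∀ x ∈ s, ∀ g : Λ, f (g • x) = OrbitCoprod.of x g * f x

variable {f : X → OrbitCoprod Λ X} {s : Set X}

namespace OrbitwiseEquivariantOn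

theorem of_forall_mem_zpowers {k : Λ} (hk : ∀ g, g ∈ Subgroup.zpowers k)
    (hs : ∀ x ∈ s, ∀ g : Λ, g • x ∈ s) (hf : ∀ x ∈ s, f (k • x) = OrbitCoprod.of x k * f x) :
    OrbitwiseEquivariantOn f s := by
  intro x hx g
  have hstep (g : Λ) : f ((k * g) • x) = OrbitCoprod.of x k * f (g • x) := by
    rw [mul_smul, hf _ (hs x hx g), OrbitCoprod.of_smul]
  obtain ⟨n, rfl⟩ := hk g
  refine zpow_induction_left (P := fun g => f (g • x) = OrbitCoprod.of x g * f x) ?_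
    (fun g ih => ?_) (fun g ih => mul_left_cancel (a := OrbitCoprod.of x k) ?_) n
  · rw [one_smul, map_one, one_mul]
  · rw [hstep, ih, map_mul, mul_assoc]
  · rw [← mul_assoc, ← map_mul, ← hstep, mul_inv_cancel_left, ih]

theorem eq_of_orbitRel (hf : OrbitwiseEquivariantOn f s) {x y : X} (hy : y ∈ s)
    (hxy : orbitRel Λ X x y) (h : f x = f y) : x = y := by
  obtain ⟨g, rfl⟩ := hxy
  have hg : OrbitCoprod.of y g = 1 := by rwa [← mul_eq_right, ← hf y hy g]
  rw [(map_eq_one_iff _ (OrbitCoprod.of_injective y)).1 hg]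
  exact one_smul Λ y

variable {y : ℕ → X}

/-- Since consecutive points differ, the successive orbits of an alternating path are distinct, so
the increments of `f` along the path spell a reduced word. -/
theorem exists_word_of_alternating_path (hf : OrbitwiseEquivariantOn f s) (hs : ∀ k, y k ∈ s)
    (hne : ∀ k, y k ≠ y (k + 1)) (horbit : ∀ k, orbitRel Λ X (y (2 * k + 1)) (y (2 * k + 2)))
    (hker : ∀ k, f (y (2 * k)) = f (y (2 * k + 1))) (k : ℕ) :
    ∃ W : Word fun _ : orbitRel.Quotient Λ X => Λ, W.toList.length = k ∧
      W.prod * f (y 0) = f (y (2 * k)) ∧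
      ∀ c ∈ W.fstIdx, c = Quotient.mk (orbitRel Λ X) (y (2 * k)) := by
  induction k with
  | zero => exact ⟨.empty, rfl, by rw [Word.prod_empty, one_mul], by simp [Word.fstIdx, Word.empty]⟩
  | succ k ih =>
    obtain ⟨W, hlength, hprod, hfst⟩ := ih
    obtain ⟨g, hg⟩ := (orbitRel Λ X).symm (horbit k)
    have hg1 : g ≠ 1 := by
      rintro rfl
      exact hne (2 * k + 1) ((one_smul Λ _).symm.trans hg)
    have hnew : W.fstIdx ≠ some (Quotient.mk (orbitRel Λ X) (y (2 * k + 1))) := fun h =>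
      hne (2 * k) <| hf.eq_of_orbitRel (hs _)
        ((orbitRel Λ X).symm (Quotient.exact (hfst _ h))) (hker k)
    refine ⟨.cons g W hnew hg1, by simp [Word.cons, hlength], ?_, fun c hc => ?_⟩
    · rw [Word.prod_cons, mul_assoc, hprod, hker]
      exact (hf _ (hs _) g).symm.trans (congrArg f hg)
    · rw [Word.fstIdx_cons, Option.mem_some_iff] at hc
      exact hc.symm.trans (Quotient.sound (horbit k))

theorem ne_of_alternating_path (hf : OrbitwiseEquivariantOn f s) (hs : ∀ k, y k ∈ s)
    (hne : ∀ k, y k ≠ y (k + 1)) (horbit : ∀ k, orbitRel Λ X (y (2 * k + 1)) (y (2 * k + 2)))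
    (hker : ∀ k, f (y (2 * k)) = f (y (2 * k + 1))) {n : ℕ} (hn : n ≠ 0) :
    f (y (2 * n)) ≠ f (y 0) := by
  classical
  obtain ⟨W, rfl, hprod, -⟩ := hf.exists_word_of_alternating_path hs hne horbit hker n
  rw [← hprod, Ne, mul_eq_right, ← Word.prod_empty]
  intro hW
  obtain rfl : W = .empty := Word.equiv.symm.injective hW
  exact hn rfl

theorem exists_eq_next_of_alternating_cycle {R S : Setoid X} (hΛ : orbitRel Λ X ≤ R)
    (hS : S ≤ R) (hker : S ≤ Setoid.ker f) {n : ℕ} (hn : n ≠ 0) (x : ZMod (2 * n) → X)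
    (hf : OrbitwiseEquivariantOn f {y | R (x 0) y})
    (hx : ∀ i, orbitRel Λ X (x (2 * i - 1)) (x (2 * i)) ∧ S (x (2 * i)) (x (2 * i + 1))) :
    ∃ j, x j = x (j + 1) := by
  by_contra! hne
  let y (k : ℕ) : X := x k
  have horbit (k : ℕ) : orbitRel Λ X (y (2 * k + 1)) (y (2 * k + 2)) := by
    convert (hx (k + 1)).1 using 2 <;> push_cast <;> ring
  have hstep (k : ℕ) : S (y (2 * k)) (y (2 * k + 1)) := by
    convert (hx k).2 using 2 <;> push_cast <;> ring
  have hmem (k : ℕ) : R (x 0) (y k) := by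
    induction k with
    | zero => exact Nat.cast_zero (R := ZMod (2 * n)) ▸ R.refl _
    | succ k ih =>
      obtain ⟨j, rfl | rfl⟩ := k.even_or_odd'
      · exact R.trans ih (hS (hstep j))
      · exact R.trans ih (hΛ (horbit j))
  refine hf.ne_of_alternating_path hmem (fun k => ?_) horbit (fun k => hker (hstep k)) hn ?_
  · simpa only [y, Nat.cast_succ] using hne k
  · simp only [y, CharP.cast_eq_zero, Nat.cast_zero]

end OrbitwiseEquivariantOn

end AlternatingCycles

section SquareLabels

variable {Y G : Type*} [Group G]

open Classical in
/-- The label of the edge removed at `u`, from `u` to `b u` if `u ∈ D` and from `u` to `a u`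
otherwise, for which the boundary of the square with edges `u — a u — b (a u)` and
`u — b u — a (b u)` has label `t u` when all kept edges have label `1`. The other removed edges of
the square start at points of smaller rank `ℓ`; the tests of `ℓ` only serve to make the recursion
terminate. -/
noncomputable def squareLabel (a b : Y → Y) (D : Set Y) (ℓ : Y → ℕ) (t : Y → G) (u : Y) : G :=
  let A : G := if _ : b u ∉ D ∧ ℓ (b u) < ℓ u then squareLabel a b D ℓ t (b u) else 1
  let B : G := if _ : a u ∈ D ∧ ℓ (a u) < ℓ u then squareLabel a b D ℓ t (a u) else 1
  if u ∈ D then A⁻¹ * t u * B else (t u * B)⁻¹ * A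
termination_by ℓ u

theorem exists_square_labels {a b : Y → Y} {D : Set Y} {ℓ : Y → ℕ}
    (ha : ∀ u, a u ∈ D → ℓ (a u) < ℓ u) (hb : ∀ u, b u ∉ D → ℓ (b u) < ℓ u) (t : Y → G) :
    ∃ A B : Y → G, (∀ u ∈ D, A u = 1) ∧ (∀ u ∉ D, B u = 1) ∧
      ∀ u, A (b u) * B u = t u * (B (a u) * A u) := by
  classical
  refine ⟨fun u => if u ∈ D then 1 else squareLabel a b D ℓ t u,
    fun u => if u ∈ D then squareLabel a b D ℓ t u else 1,
    fun u hu => if_pos hu, fun u hu => if_neg hu, fun u => ?_⟩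
  have hA : (b u ∉ D ∧ ℓ (b u) < ℓ u) ↔ b u ∉ D := and_iff_left_of_imp (hb u)
  have hB : (a u ∈ D ∧ ℓ (a u) < ℓ u) ↔ a u ∈ D := and_iff_left_of_imp (ha u)
  have hlabel := squareLabel.eq_def a b D ℓ t u
  simp only [hA, hB, dite_eq_ite, ite_not] at hlabel
  by_cases hu : u ∈ D <;> simp only [hu, if_true, if_false] at hlabel ⊢ <;> rw [hlabel] <;> group

end SquareLabels

theorem rel_mul_of_mem_closure {Γ : Type*} [Group Γ] {T : Setoid Γ} {K : Set Γ}
    (hK : ∀ k ∈ K, ∀ h, T h (k * h)) {g : Γ} (hg : g ∈ Subgroup.closure K) (h : Γ) :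
    T h (g * h) := by
  induction hg using Subgroup.closure_induction generalizing h with
  | mem k hk => exact hK k hk h
  | one => rw [one_mul]
  | mul g g' _ _ ihg ihg' => rw [mul_assoc]; exact T.trans (ihg' h) (ihg _)
  | inv g _ ih => exact T.symm (by simpa only [mul_inv_cancel_left] using ih (g⁻¹ * h))

section CayleyTree

open FreeGroup (of)
open scoped commutatorElement

variable {α G : Type*} [Group G]

theorem exists_forall_of_mul_eq_mul (c : α → FreeGroup α → G) :
    ∃ F : FreeGroup α → G, ∀ s h, F (of s * h) = c s h * F h := by
  let e (s : α) : Equiv.Perm (FreeGroup α × G) :=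
    Equiv.prodShear (Equiv.mulLeft (of s)) fun h => Equiv.mulLeft (c s h)
  have hfst (g : FreeGroup α) : ∀ q, (FreeGroup.lift e g q).1 = g * q.1 := by
    induction g using FreeGroup.induction_on with
    | C1 => intro q; rw [map_one, one_mul]; rfl
    | of s => intro q; rw [FreeGroup.lift_apply_of]; rfl
    | inv_of s _ => intro q; rw [map_inv, FreeGroup.lift_apply_of]; rfl
    | mul g h hg hh => intro q; rw [map_mul, Equiv.Perm.mul_apply, hg, hh, mul_assoc]
  refine ⟨fun h => (FreeGroup.lift e h (1, 1)).2, fun s h => ?_⟩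
  have hs : (FreeGroup.lift e (of s * h) (1, 1)).2 =
      c s (FreeGroup.lift e h (1, 1)).1 * (FreeGroup.lift e h (1, 1)).2 := by
    rw [map_mul, FreeGroup.lift_apply_of]; rfl
  simpa only [hfst, mul_one] using hs

variable {a b : α} {D : Set (FreeGroup α)} {ℓ : FreeGroup α → ℕ} {w : FreeGroup α}

/-- The domain on which the edges from `x` to `s x` are kept: `a`-edges are kept on `D`, `b`-edges
off `D`, and the edges of every other generator everywhere. -/
def keptDomain {X : Type*} (a b : α) (D : Set X) (s : α) : Set X :=
  {x | (s = a → x ∈ D) ∧ (s = b → x ∉ D)}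

theorem rel_mul_of_rel_keptDomain {T : Setoid (FreeGroup α)}
    (hT : ∀ s, ∀ h ∈ keptDomain a b D s, T h (of s * h))
    (hw : w ∈ Subgroup.closure (of '' {s | s ≠ a ∧ s ≠ b})) (h : FreeGroup α) : T h (w * h) := by
  refine rel_mul_of_mem_closure ?_ hw h
  rintro _ ⟨s, ⟨hsa, hsb⟩, rfl⟩ h
  exact hT s h ⟨fun hs => absurd hs hsa, fun hs => absurd hs hsb⟩

theorem commutator_mul_mul_inv_mul_eq {Γ : Type*} [Group Γ] (a b w u : Γ) :
    ⁅a, b⁆ * w * (w⁻¹ * (b * (a * u))) = a * (b * u) := by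
  group

/-- Induction on the rank: the square at `u` recovers the edge removed at `u` from the other edges
of its boundary. -/
theorem eq_top_of_rel_keptDomain (hab : a ≠ b)
    (hw : w ∈ Subgroup.closure (of '' {s | s ≠ a ∧ s ≠ b}))
    (ha : ∀ u, of a * u ∈ D → ℓ (of a * u) < ℓ u) (hb : ∀ u, of b * u ∉ D → ℓ (of b * u) < ℓ u)
    {T : Setoid (FreeGroup α)} (hκ : ∀ h, T h (⁅of a, of b⁆ * w * h))
    (hT : ∀ s, ∀ h ∈ keptDomain a b D s, T h (of s * h)) : T = ⊤ := by
  have ha_kept {u} (hu : u ∈ D) : T u (of a * u) := hT a u ⟨fun _ => hu, fun h => absurd h hab⟩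
  have hb_kept {u} (hu : u ∉ D) : T u (of b * u) :=
    hT b u ⟨fun h => absurd h hab.symm, fun _ => hu⟩
  have hsquare (u) : T (of b * (of a * u)) (of a * (of b * u)) := by
    have hw' := rel_mul_of_rel_keptDomain hT hw (w⁻¹ * (of b * (of a * u)))
    rw [mul_inv_cancel_left] at hw'
    exact T.trans (T.symm hw') (commutator_mul_mul_inv_mul_eq (of a) (of b) w u ▸ hκ _)
  have hab_rel (n : ℕ) : ∀ u, ℓ u = n → T u (of a * u) ∧ T u (of b * u) := by
    induction n using Nat.strong_induction_on with
    | _ n ih =>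
      rintro u rfl
      have hau : T (of a * u) (of b * (of a * u)) :=
        (em (of a * u ∈ D)).elim (fun h => (ih _ (ha u h) _ rfl).2) hb_kept
      have hbu : T (of b * u) (of a * (of b * u)) :=
        (em (of b * u ∈ D)).elim ha_kept fun h => (ih _ (hb u h) _ rfl).1
      have hdiag : T (of a * u) (of b * u) := T.trans hau (T.trans (hsquare u) (T.symm hbu))
      by_cases hu : u ∈ D
      · exact ⟨ha_kept hu, T.trans (ha_kept hu) hdiag⟩
      · exact ⟨T.trans (hb_kept hu) (T.symm hdiag), hb_kept hu⟩
  have hgen : ∀ g ∈ Set.range of, ∀ u, T u (g * u) := by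
    rintro _ ⟨s, rfl⟩ u
    obtain rfl | hsa := eq_or_ne s a
    · exact (hab_rel _ u rfl).1
    obtain rfl | hsb := eq_or_ne s b
    · exact (hab_rel _ u rfl).2
    exact hT s u ⟨fun h => absurd h hsa, fun h => absurd h hsb⟩
  refine top_unique fun g h _ => ?_
  have hgh : h * g⁻¹ ∈ Subgroup.closure (Set.range of) := by
    rw [FreeGroup.closure_range_of]; exact Subgroup.mem_top _
  simpa only [inv_mul_cancel_right] using rel_mul_of_mem_closure hgen hgh g

theorem exists_increments_of_keptDomain (hab : a ≠ b)
    (hw : w ∈ Subgroup.closure (of '' {s | s ≠ a ∧ s ≠ b}))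
    (ha : ∀ u, of a * u ∈ D → ℓ (of a * u) < ℓ u) (hb : ∀ u, of b * u ∉ D → ℓ (of b * u) < ℓ u)
    (t : FreeGroup α → G) :
    ∃ F : FreeGroup α → G, (∀ s, ∀ h ∈ keptDomain a b D s, F (of s * h) = F h) ∧
      ∀ h, F (⁅of a, of b⁆ * w * h) = t h * F h := by
  classical
  obtain ⟨A, B, hA, hB, hAB⟩ :=
    exists_square_labels ha hb fun u => t (w⁻¹ * (of b * (of a * u)))
  obtain ⟨F, hF⟩ := exists_forall_of_mul_eq_mul fun s h =>
    if s = a then A h else if s = b then B h else 1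
  have hFa (h) : F (of a * h) = A h * F h := by rw [hF, if_pos rfl]
  have hFb (h) : F (of b * h) = B h * F h := by rw [hF, if_neg hab.symm, if_pos rfl]
  have hkept : ∀ s, ∀ h ∈ keptDomain a b D s, F (of s * h) = F h := by
    intro s h hs
    obtain rfl | hsa := eq_or_ne s a
    · rw [hFa, hA h (hs.1 rfl), one_mul]
    obtain rfl | hsb := eq_or_ne s b
    · rw [hFb, hB h (hs.2 rfl), one_mul]
    rw [hF, if_neg hsa, if_neg hsb, one_mul]
  have hFw (h) : F (w * h) = F h :=
    (rel_mul_of_rel_keptDomain (T := Setoid.ker F) (fun s h hs => (hkept s h hs).symm) hw h).symm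
  refine ⟨F, hkept, fun h => ?_⟩
  obtain ⟨u, rfl⟩ : ∃ u, h = w⁻¹ * (of b * (of a * u)) :=
    ⟨(of a)⁻¹ * ((of b)⁻¹ * (w * h)), by simp only [mul_inv_cancel_left, inv_mul_cancel_left]⟩
  rw [← hFw (w⁻¹ * _), mul_inv_cancel_left, commutator_mul_mul_inv_mul_eq, hFa, hFb, hFb, hFa,
    ← mul_assoc, hAB, mul_assoc, mul_assoc]

end CayleyTree

section Graphings

variable {ι X : Type*}

/-- The equivalence relation generated by the graphing consisting of the partial maps `φ i` with
domains `A i`. -/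
def graphingRel (φ : ι → X → X) (A : ι → Set X) : Setoid X :=
  Relation.EqvGen.setoid fun x y => ∃ i, x ∈ A i ∧ φ i x = y

theorem graphingRel_of_mem {φ : ι → X → X} {A : ι → Set X} {i : ι} {x : X} (hx : x ∈ A i) :
    graphingRel φ A x (φ i x) :=
  .rel _ _ ⟨i, hx, rfl⟩

theorem graphingRel_le {φ : ι → X → X} {A : ι → Set X} {T : Setoid X}
    (h : ∀ i, ∀ x ∈ A i, T x (φ i x)) : graphingRel φ A ≤ T :=
  Setoid.eqvGen_le <| by rintro x _ ⟨i, hx, rfl⟩; exact h i x hx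

variable [Countable ι] [MeasurableSpace X] [MeasurableEq X] {A : ι → Set X}

theorem measurableSet_reflTransGen {ψ : ι → X → X} (hψ : ∀ i, Measurable (ψ i))
    (hA : ∀ i, MeasurableSet (A i)) :
    MeasurableSet {q : X × X |
      Relation.ReflTransGen (fun x y => ∃ i, x ∈ A i ∧ ψ i x = y) q.1 q.2} := by
  let P (n : ℕ) : Set (X × X) := Nat.rec (Set.diagonal X)
    (fun _ Q => ⋃ i, Prod.fst ⁻¹' A i ∩ Prod.map (ψ i) id ⁻¹' Q) n
  have hP (n : ℕ) : MeasurableSet (P n) := by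
    induction n with
    | zero => exact measurableSet_diagonal
    | succ n ih =>
      exact .iUnion fun i => (measurable_fst (hA i)).inter (((hψ i).prodMap measurable_id) ih)
  convert MeasurableSet.iUnion hP
  refine Set.Subset.antisymm ?_ (Set.iUnion_subset fun n => ?_)
  · rintro ⟨x, y⟩ (hxy : Relation.ReflTransGen _ x y)
    induction hxy using Relation.ReflTransGen.head_induction_on with
    | refl => exact Set.mem_iUnion.2 ⟨0, rfl⟩
    | head hstep _ ih =>
      obtain ⟨i, hx, rfl⟩ := hstep
      obtain ⟨n, hn⟩ := Set.mem_iUnion.1 ih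
      exact Set.mem_iUnion.2 ⟨n + 1, Set.mem_iUnion.2 ⟨i, hx, hn⟩⟩
  · induction n with
    | zero => rintro ⟨x, y⟩ (rfl : x = y); exact .refl
    | succ n ih =>
      rintro ⟨x, y⟩ hxy
      obtain ⟨i, hx, hn⟩ := Set.mem_iUnion.1 hxy
      exact .head ⟨i, hx, rfl⟩ (ih hn)

theorem measurableSet_graphingRel (φ : ι → X ≃ᵐ X) (hA : ∀ i, MeasurableSet (A i)) :
    MeasurableSet {q : X × X | graphingRel (fun i => φ i) A q.1 q.2} := by
  let ψ : ι ⊕ ι → X → X := Sum.elim (fun i => φ i) fun i => (φ i).symm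
  let B : ι ⊕ ι → Set X := Sum.elim A fun i => (φ i).symm ⁻¹' A i
  have hψ : ∀ i, Measurable (ψ i) := Sum.rec (fun i => (φ i).measurable) fun i =>
    (φ i).symm.measurable
  have hB : ∀ i, MeasurableSet (B i) := Sum.rec hA fun i => (φ i).symm.measurable (hA i)
  have hsymm : Relation.SymmGen (fun x y => ∃ i, x ∈ A i ∧ φ i x = y) =
      fun x y => ∃ i, x ∈ B i ∧ ψ i x = y := by
    ext x y
    have hback (i : ι) : y ∈ A i ∧ φ i y = x ↔ (φ i).symm x ∈ A i ∧ (φ i).symm x = y := by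
      rw [(φ i).symm_apply_eq, eq_comm, and_congr_left_iff]
      rintro rfl
      rw [(φ i).symm_apply_apply]
    simp only [Relation.SymmGen, Sum.exists, hback, ψ, B, Sum.elim_inl, Sum.elim_inr,
      Set.mem_preimage]
  convert measurableSet_reflTransGen hψ hB using 4 with q
  rw [← hsymm, Relation.EqvGen.reflTransGen_symmGen]
  rfl

end Graphings

theorem injective_smul_of_stabilizer_eq_bot {Γ X : Type*} [Group Γ] [MulAction Γ X] {x : X}
    (hx : MulAction.stabilizer Γ x = ⊥) : Function.Injective fun g : Γ => g • x := by
  intro g h (hgh : g • x = h • x)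
  have hmem : h⁻¹ * g ∈ MulAction.stabilizer Γ x := by
    rw [MulAction.mem_stabilizer_iff, mul_smul, hgh, inv_smul_smul]
  rw [hx, Subgroup.mem_bot, inv_mul_eq_one] at hmem
  exact hmem.symm

theorem ae_forall_smul (Γ : Type*) {X : Type*} [Group Γ] [Countable Γ] [MulAction Γ X]
    [MeasurableSpace X] [MeasurableConstSMul Γ X] {μ : Measure X} [SMulInvariantMeasure Γ X μ]
    {p : X → Prop} (hp : ∀ᵐ x ∂μ, p x) : ∀ᵐ x ∂μ, ∀ g : Γ, p (g • x) :=
  ae_all_iff.2 fun g => (measurePreserving_smul g μ).quasiMeasurePreserving.ae hp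

section KeptRel

open MulAction
open FreeGroup (of)
open scoped commutatorElement

variable {α X : Type*} [MulAction (FreeGroup α) X]

/-- The equivalence relation generated by the kept edges of the orbits of a free group action. -/
def keptRel (a b : α) (D : Set X) : Setoid X :=
  graphingRel (fun s x => of s • x) (keptDomain a b D)

variable {a b : α} {D : Set X}

theorem measurableSet_keptRel [Countable α] [MeasurableSpace X] [MeasurableEq X]
    [MeasurableConstSMul (FreeGroup α) X] (hD : MeasurableSet D) :
    MeasurableSet {q : X × X | keptRel a b D q.1 q.2} := by
  refine measurableSet_graphingRel (fun s => MeasurableEquiv.smul (of s)) fun s => ?_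
  exact (MeasurableSet.imp (.const _) hD).inter (MeasurableSet.imp (.const _) hD.compl)

theorem keptRel_le_orbitRel : keptRel a b D ≤ orbitRel (FreeGroup α) X :=
  graphingRel_le fun s x _ => (orbitRel (FreeGroup α) X).symm (mem_orbit x (of s))

variable {ℓ : X → ℕ} {w : FreeGroup α} {x₀ : X}

theorem orbitRel_zpowers_sup_keptRel_of_orbitRel (hab : a ≠ b)
    (hw : w ∈ Subgroup.closure (of '' {s | s ≠ a ∧ s ≠ b}))
    (ha : ∀ g : FreeGroup α, (of a * g) • x₀ ∈ D → ℓ ((of a * g) • x₀) < ℓ (g • x₀))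
    (hb : ∀ g : FreeGroup α, (of b * g) • x₀ ∉ D → ℓ ((of b * g) • x₀) < ℓ (g • x₀))
    {y : X} (hy : orbitRel (FreeGroup α) X x₀ y) :
    (orbitRel (Subgroup.zpowers (⁅of a, of b⁆ * w)) X ⊔ keptRel a b D) x₀ y := by
  set R := orbitRel (Subgroup.zpowers (⁅of a, of b⁆ * w)) X ⊔ keptRel a b D
  have htop : R.comap (fun g : FreeGroup α => g • x₀) = ⊤ := by
    refine eq_top_of_rel_keptDomain (D := (· • x₀) ⁻¹' D) (ℓ := fun g => ℓ (g • x₀)) hab hw ha hb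
      (fun g => ?_) fun s g hg => ?_
    · refine R.symm ((le_sup_left : _ ≤ R) ?_)
      exact ⟨⟨_, Subgroup.mem_zpowers _⟩, (mul_smul _ g x₀).symm⟩
    · rw [Setoid.comap_rel, mul_smul]
      exact (le_sup_right : _ ≤ R) (graphingRel_of_mem (φ := fun s x => of s • x) hg)
  obtain ⟨g, rfl⟩ := (orbitRel (FreeGroup α) X).symm hy
  have hg : R.comap (fun g : FreeGroup α => g • x₀) 1 g := htop ▸ trivial
  rwa [Setoid.comap_rel, one_smul] at hg

/-- The function is transported from the Cayley tree to the free orbit of `x₀`. -/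
theorem exists_orbitwiseEquivariantOn_keptRel_le_ker (hfree : stabilizer (FreeGroup α) x₀ = ⊥)
    (hab : a ≠ b) (hw : w ∈ Subgroup.closure (of '' {s | s ≠ a ∧ s ≠ b}))
    (ha : ∀ g : FreeGroup α, (of a * g) • x₀ ∈ D → ℓ ((of a * g) • x₀) < ℓ (g • x₀))
    (hb : ∀ g : FreeGroup α, (of b * g) • x₀ ∉ D → ℓ ((of b * g) • x₀) < ℓ (g • x₀)) :
    ∃ f : X → OrbitCoprod (Subgroup.zpowers (⁅of a, of b⁆ * w)) X,
      OrbitwiseEquivariantOn f {y | orbitRel (FreeGroup α) X x₀ y} ∧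
        keptRel a b D ≤ Setoid.ker f := by
  let k : Subgroup.zpowers (⁅of a, of b⁆ * w) := ⟨_, Subgroup.mem_zpowers _⟩
  obtain ⟨F, hkept, hκ⟩ := exists_increments_of_keptDomain (D := (· • x₀) ⁻¹' D)
    (ℓ := fun g => ℓ (g • x₀)) hab hw ha hb fun g => OrbitCoprod.of (g • x₀) k
  have hinj := injective_smul_of_stabilizer_eq_bot hfree
  let f := Function.extend (fun g : FreeGroup α => g • x₀) F 1
  have hf_orbit (g : FreeGroup α) : f (g • x₀) = F g := hinj.extend_apply F 1 g
  have hf_of_notMem {y} (hy : y ∉ orbit (FreeGroup α) x₀) : f y = 1 :=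
    Function.extend_apply' _ _ _ hy
  refine ⟨f, .of_forall_mem_zpowers (k := k) ?_ (fun x hx g => ?_) fun x hx => ?_,
    graphingRel_le fun s x hx => ?_⟩
  · rintro ⟨_, n, rfl⟩
    exact ⟨n, rfl⟩
  · exact (orbitRel (FreeGroup α) X).trans hx
      ((orbitRel (FreeGroup α) X).symm (mem_orbit x (g : FreeGroup α)))
  · obtain ⟨g, rfl⟩ := (orbitRel (FreeGroup α) X).symm hx
    change f ((⁅of a, of b⁆ * w) • g • x₀) = _ * f (g • x₀)
    rw [← mul_smul, hf_orbit, hf_orbit, hκ]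
  · by_cases hx_orbit : x ∈ orbit (FreeGroup α) x₀
    · obtain ⟨g, rfl⟩ := hx_orbit
      change f (g • x₀) = f (of s • g • x₀)
      rw [← mul_smul, hf_orbit, hf_orbit, hkept s g hx]
    · exact (hf_of_notMem hx_orbit).trans
        (hf_of_notMem fun h => hx_orbit (orbit_eq_iff.2 h ▸ mem_orbit_smul (of s) x)).symm

theorem isFreeProductRel_keptRel [Countable α] [MeasurableSpace X] {μ : Measure X}
    [MeasurableConstSMul (FreeGroup α) X] [SMulInvariantMeasure (FreeGroup α) X μ]
    (hfree : IsEssentiallyFree (FreeGroup α) μ) (hab : a ≠ b)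
    (hw : w ∈ Subgroup.closure (of '' {s | s ≠ a ∧ s ≠ b}))
    (ha : ∀ᵐ x ∂μ, of a • x ∈ D → ℓ (of a • x) < ℓ x)
    (hb : ∀ᵐ x ∂μ, of b • x ∉ D → ℓ (of b • x) < ℓ x) :
    IsFreeProductRel μ (orbitRel (FreeGroup α) X)
      (orbitRel (Subgroup.zpowers (⁅of a, of b⁆ * w)) X) (keptRel a b D) := by
  replace ha := ae_forall_smul (FreeGroup α) ha
  replace hb := ae_forall_smul (FreeGroup α) hb
  simp only [← mul_smul] at ha hb
  refine ⟨orbitRel_subgroup_le _, keptRel_le_orbitRel, ?_, ?_⟩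
  · filter_upwards [ha, hb] with x hax hbx y
    exact orbitRel_zpowers_sup_keptRel_of_orbitRel hab hw hax hbx
  · filter_upwards [hfree, ha, hb]
    rintro _ hx hax hbx n hn x rfl
    obtain ⟨f, hf, hker⟩ := exists_orbitwiseEquivariantOn_keptRel_le_ker hx hab hw hax hbx
    exact hf.exists_eq_next_of_alternating_cycle (orbitRel_subgroup_le _) keptRel_le_orbitRel hker
      (Nat.one_le_iff_ne_zero.1 hn) x

end KeptRel

section InfiniteProducts

variable {ι κ Y : Type*} [MeasurableSpace Y] (μ : Measure Y) [IsProbabilityMeasure μ]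

theorem measurePreserving_infinitePi_comp {f : κ → ι} (hf : Function.Injective f) :
    MeasurePreserving (fun x : ι → Y => x ∘ f) (Measure.infinitePi fun _ => μ)
      (Measure.infinitePi fun _ => μ) :=
  ⟨measurable_pi_lambda _ fun k => measurable_pi_apply (f k),
    Measure.map_infinitePi_infinitePi_of_inj (P := fun _ => μ) hf⟩

variable {μ} in
theorem measurePreserving_infinitePi_map {f : ι → Y → Y}
    (hf : ∀ i, MeasurePreserving (f i) μ μ) :
    MeasurePreserving (fun (x : ι → Y) i => f i (x i)) (Measure.infinitePi fun _ => μ)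
      (Measure.infinitePi fun _ => μ) := by
  have hmeas := fun i => (hf i).measurable
  exact ⟨by fun_prop, by simp only [Measure.infinitePi_map_pi _ hmeas, (hf _).map_eq]⟩

theorem ae_apply_ne_apply_infinitePi [MeasurableEq Y] [NullSingletonClass μ] {i j : ι}
    (hij : i ≠ j) : ∀ᵐ x ∂(Measure.infinitePi fun _ : ι => μ), x i ≠ x j := by
  have hdiag : ∀ᵐ q ∂μ.prod μ, q.1 ≠ q.2 := by
    refine (Measure.ae_prod_iff_ae_ae measurableSet_diagonal.compl).2 ?_
    filter_upwards with y
    filter_upwards [Measure.ae_ne μ y] with z hz using hz.symm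
  rw [← Measure.infinitePi_map_eval_prod (P := fun _ => μ) hij] at hdiag
  exact ae_of_ae_map (f := fun x : ι → Y => (x i, x j)) (by fun_prop) hdiag

theorem ae_exists_mem_infinitePi {s : Set Y} (hs : MeasurableSet s) (hμs : μ s ≠ 0) {T : Set ι}
    (hT : T.Infinite) : ∀ᵐ x ∂(Measure.infinitePi fun _ : ι => μ), ∃ i ∈ T, x i ∈ s := by
  have hbound (n : ℕ) :
      Measure.infinitePi (fun _ : ι => μ) {x | ¬ ∃ i ∈ T, x i ∈ s} ≤ μ sᶜ ^ n := by
    obtain ⟨F, hFT, rfl⟩ := hT.exists_subset_card_eq n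
    calc Measure.infinitePi (fun _ : ι => μ) {x | ¬ ∃ i ∈ T, x i ∈ s}
        ≤ Measure.infinitePi (fun _ : ι => μ) (Set.pi F fun _ => sᶜ) :=
          measure_mono fun x hx i hi hxi => hx ⟨i, hFT hi, hxi⟩
      _ = μ sᶜ ^ F.card := by
          rw [Measure.infinitePi_pi _ fun _ _ => hs.compl, Finset.prod_const]
  have hlt : μ sᶜ < 1 := by
    rw [prob_compl_eq_one_sub hs]
    exact ENNReal.sub_lt_self ENNReal.one_ne_top one_ne_zero hμs
  exact le_bot_iff.1 (ge_of_tendsto' (ENNReal.tendsto_pow_atTop_nhds_zero_of_lt_one hlt) hbound)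

end InfiniteProducts

section FreeExtensions

open MulAction

attribute [local instance] arrowAction

variable {Γ A Y Z : Type*} [Group Γ] [MulAction Γ A] [MulAction Γ Z]
  [MeasurableSpace Y] [MeasurableSpace Z]

theorem measurableConstSMul_arrow : MeasurableConstSMul Γ (A → Y) :=
  ⟨fun g => measurable_pi_lambda _ fun a => measurable_pi_apply (g⁻¹ • a)⟩

attribute [local instance] measurableConstSMul_arrow

theorem smulInvariantMeasure_infinitePi (ν : Measure Y) [IsProbabilityMeasure ν] :
    SMulInvariantMeasure Γ (A → Y) (Measure.infinitePi fun _ => ν) :=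
  ⟨fun g _ hs => (measurePreserving_infinitePi_comp ν
    (MulAction.injective g⁻¹)).measure_preimage hs.nullMeasurableSet⟩

attribute [local instance] smulInvariantMeasure_infinitePi

theorem isEssentiallyFree_infinitePi [Countable Γ] [FaithfulSMul Γ A] [MeasurableEq Y]
    (ν : Measure Y) [IsProbabilityMeasure ν] [NullSingletonClass ν] :
    IsEssentiallyFree Γ (Measure.infinitePi fun _ : A => ν) := by
  have hmoved (g : Γ) : ∀ᵐ y ∂(Measure.infinitePi fun _ : A => ν), g ≠ 1 → g • y ≠ y := by
    by_cases hg : g = 1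
    · exact .of_forall fun _ hne => absurd hg hne
    obtain ⟨a, ha⟩ : ∃ a : A, g⁻¹ • a ≠ a := by
      by_contra! h
      exact hg (inv_eq_one.1 (FaithfulSMul.eq_of_smul_eq_smul fun a : A => by rw [h, one_smul]))
    filter_upwards [ae_apply_ne_apply_infinitePi ν ha] with y hy _ h using hy (congr_fun h a)
  filter_upwards [ae_all_iff.2 hmoved] with y hy
  exact (Subgroup.eq_bot_iff_forall _).2 fun g hg => by_contra fun hg_ne => hy g hg_ne hg

instance measurableConstSMul_prod [MulAction Γ Y] [MeasurableConstSMul Γ Y]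
    [MeasurableConstSMul Γ Z] : MeasurableConstSMul Γ (Y × Z) :=
  ⟨fun g => (measurable_const_smul g).prodMap (measurable_const_smul g)⟩

instance smulInvariantMeasure_prod [MulAction Γ Y] [MeasurableConstSMul Γ Y]
    [MeasurableConstSMul Γ Z] (ν : Measure Y) (μ : Measure Z) [SFinite ν] [SFinite μ]
    [SMulInvariantMeasure Γ Y ν] [SMulInvariantMeasure Γ Z μ] :
    SMulInvariantMeasure Γ (Y × Z) (ν.prod μ) :=
  ⟨fun g _ hs => ((measurePreserving_smul g ν).prod (measurePreserving_smul g μ)).measure_preimage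
    hs.nullMeasurableSet⟩

theorem IsEssentiallyFree.prod_right [MulAction Γ Y] {μ : Measure Z}
    (hμ : IsEssentiallyFree Γ μ) (ν : Measure Y) : IsEssentiallyFree Γ (ν.prod μ) := by
  filter_upwards [Measure.quasiMeasurePreserving_snd.ae hμ] with q hq
  exact eq_bot_iff.2 (hq ▸ fun g hg => congr_arg Prod.snd hg)

theorem measurableSet_orbitRel [Countable Γ] [MeasurableEq Z] [MeasurableConstSMul Γ Z] :
    MeasurableSet {q : Z × Z | orbitRel Γ Z q.1 q.2} := by
  have hunion : {q : Z × Z | orbitRel Γ Z q.1 q.2} = ⋃ g : Γ, {q | g • q.2 = q.1} := by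
    ext q
    simp only [orbitRel_apply, mem_orbit_iff, Set.mem_ofPred_eq, Set.mem_iUnion]
  rw [hunion]
  exact .iUnion fun g => measurableSet_eq_fun (measurable_snd.const_smul g) measurable_fst

theorem orbitRel_eq_bot_of_subsingleton {Γ Z : Type*} [Group Γ] [Subsingleton Γ] [MulAction Γ Z] :
    orbitRel Γ Z = ⊥ := by
  refine le_bot_iff.1 ?_
  rintro _ z ⟨g, rfl⟩
  rw [Subsingleton.elim g 1]
  exact one_smul Γ z

theorem isFreeProductRel_bot_left (μ : Measure Z) (R : Setoid Z) : IsFreeProductRel μ R ⊥ R where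
  left_le := bot_le
  right_le := le_rfl
  generates := .of_forall fun _ _ h => (le_sup_right : R ≤ ⊥ ⊔ R) h
  no_reduced_cycle := .of_forall fun _ _ _ x _ h => ⟨2 * 0 - 1, by simpa using (h 0).1⟩

theorem isMeasureFreeFactor_bot {Γ : Type} [Group Γ] [Countable Γ] :
    IsMeasureFreeFactor (⊥ : Subgroup Γ) := by
  refine ⟨Γ → unitInterval, inferInstance, inferInstance, Measure.infinitePi fun _ => volume,
    inferInstance, inferInstance, inferInstance, inferInstance, isEssentiallyFree_infinitePi _,
    orbitRel Γ _, measurableSet_orbitRel, ?_⟩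
  rw [orbitRel_eq_bot_of_subsingleton (Γ := (⊥ : Subgroup Γ))]
  exact isFreeProductRel_bot_left _ _

open FreeGroup (of)
open scoped commutatorElement

/-- The given action need not be free: it is multiplied by a Bernoulli action. -/
theorem isMeasureFreeFactor_zpowers_of_rank {α : Type} [Countable α] {a b : α} (hab : a ≠ b)
    {w : FreeGroup α} (hw : w ∈ Subgroup.closure (of '' {s | s ≠ a ∧ s ≠ b}))
    {Z : Type} [MeasurableSpace Z] [StandardBorelSpace Z] (μ : Measure Z) [IsProbabilityMeasure μ]
    [MulAction (FreeGroup α) Z] [MeasurableConstSMul (FreeGroup α) Z]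
    [SMulInvariantMeasure (FreeGroup α) Z μ] {D : Set Z} (hD : MeasurableSet D) {ℓ : Z → ℕ}
    (ha : ∀ᵐ z ∂μ, of a • z ∈ D → ℓ (of a • z) < ℓ z)
    (hb : ∀ᵐ z ∂μ, of b • z ∉ D → ℓ (of b • z) < ℓ z) :
    IsMeasureFreeFactor (Subgroup.zpowers (⁅of a, of b⁆ * w)) := by
  let ν : Measure (FreeGroup α → unitInterval) := Measure.infinitePi fun _ => volume
  have hfree : IsEssentiallyFree (FreeGroup α) (μ.prod ν) :=
    (isEssentiallyFree_infinitePi _).prod_right μ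
  exact ⟨Z × (FreeGroup α → unitInterval), inferInstance, inferInstance, μ.prod ν, inferInstance,
    inferInstance, inferInstance, inferInstance, hfree, keptRel a b (Prod.fst ⁻¹' D),
    measurableSet_keptRel (measurable_fst hD),
    isFreeProductRel_keptRel (ℓ := fun q => ℓ q.1) hfree hab hw
      (Measure.quasiMeasurePreserving_fst.ae ha) (Measure.quasiMeasurePreserving_fst.ae hb)⟩

end FreeExtensions

section CoinTosses

open ProbabilityTheory

theorem measurePreserving_uniformOn_univ {Ω Ω' : Type*} [MeasurableSpace Ω] [MeasurableSpace Ω']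
    (e : Ω ≃ᵐ Ω') : MeasurePreserving e (uniformOn Set.univ) (uniformOn Set.univ) := by
  have hcount {s : Set Ω'} (hs : MeasurableSet s) :
      (Measure.count (e ⁻¹' s) : ENNReal) = Measure.count s := by
    rw [Measure.count_apply (e.measurable hs), Measure.count_apply hs,
      Set.encard_preimage_of_bijective e.bijective]
  refine ⟨e.measurable, Measure.ext fun s hs => ?_⟩
  simp only [uniformOn, e.map_apply, cond_apply .univ, Set.univ_inter, hcount hs,
    ← hcount .univ, Set.preimage_univ]

/-- The law of a sequence of independent fair coin tosses indexed by the integers. -/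
noncomputable abbrev coinSequence : Measure (ℤ → Bool) :=
  Measure.infinitePi fun _ => uniformOn Set.univ

/-- The transformation turning over the coin at the position `0`. -/
def flipZero : (ℤ → Bool) ≃ᵐ (ℤ → Bool) :=
  .ofInvolutive (fun x => Function.update x 0 (!x 0)) (fun x => by simp) (by fun_prop)

/-- The transformation moving each coin one position to the right. -/
def shiftRight : (ℤ → Bool) ≃ᵐ (ℤ → Bool) :=
  .arrowCongr' (Equiv.subRight 1).symm (.refl Bool)

theorem flipZero_apply (x : ℤ → Bool) : flipZero x = Function.update x 0 (!x 0) := rfl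

theorem shiftRight_apply (x : ℤ → Bool) (i : ℤ) : shiftRight x i = x (i - 1) := rfl

theorem measurePreserving_flipZero : MeasurePreserving flipZero coinSequence coinSequence := by
  have hcoord : (flipZero : (ℤ → Bool) → ℤ → Bool) =
      fun x i => (if i = 0 then not else id) (x i) := by
    funext x i
    by_cases hi : i = 0 <;> simp [flipZero_apply, hi]
  rw [hcoord]
  refine measurePreserving_infinitePi_map fun i => ?_
  split_ifs
  · exact measurePreserving_uniformOn_univ
      (.ofInvolutive not Bool.involutive_not (measurable_of_countable not))
  · exact .id _

theorem measurePreserving_shiftRight : MeasurePreserving shiftRight coinSequence coinSequence :=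
  measurePreserving_infinitePi_comp _ (sub_left_injective (b := 1))

/-- The number of consecutive `true` values of `x` at the positions `-1, -2, …`, or `0` if there
are infinitely many. -/
noncomputable def runLength (x : ℤ → Bool) : ℕ := sInf {k : ℕ | x (-(k + 1)) = false}

/-- A quantity which drops when the coin at `0` is flipped to `false`, and when a `true` is shifted
to the position `0`. -/
noncomputable def coinRank (x : ℤ → Bool) : ℕ := 2 * runLength x + (x 0).toNat

theorem runLength_flipZero (x : ℤ → Bool) : runLength (flipZero x) = runLength x := by
  have hneg (k : ℕ) : -((k : ℤ) + 1) ≠ 0 := by omega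
  simp only [runLength, flipZero_apply, Function.update_of_ne (hneg _)]

theorem runLength_shiftRight {x : ℤ → Bool} (hx : shiftRight x 0 = true)
    (hfalse : ∃ k : ℕ, x (-(k + 1)) = false) : runLength x = runLength (shiftRight x) + 1 := by
  have hx' : x (-(0 + 1)) = true := hx
  have hpos : 0 < runLength x := Nat.pos_of_ne_zero fun h => by
    have hmem : x (-(runLength x + 1)) = false := Nat.sInf_mem hfalse
    rw [h, Nat.cast_zero, hx'] at hmem
    exact absurd hmem (by decide)
  have hshift (k : ℕ) : shiftRight x (-(k + 1)) = x (-((k + 1 : ℕ) + 1)) := by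
    rw [shiftRight_apply]
    push_cast
    ring_nf
  simp only [runLength, hshift]
  exact (Nat.sInf_add (p := fun k : ℕ => x (-(k + 1)) = false) hpos).symm

theorem coinRank_flipZero_lt {x : ℤ → Bool} (hx : flipZero x 0 = false) :
    coinRank (flipZero x) < coinRank x := by
  have hx0 : x 0 = true := by simpa [flipZero_apply] using hx
  simp only [coinRank, runLength_flipZero, hx, hx0, Bool.toNat_false, Bool.toNat_true]
  omega

theorem coinRank_shiftRight_lt {x : ℤ → Bool} (hx : shiftRight x 0 = true)
    (hfalse : ∃ k : ℕ, x (-(k + 1)) = false) : coinRank (shiftRight x) < coinRank x := by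
  simp only [coinRank, runLength_shiftRight hx hfalse, hx, Bool.toNat_true]
  omega

theorem ae_exists_eq_false : ∀ᵐ x ∂coinSequence, ∃ k : ℕ, x (-(k + 1)) = false := by
  have hinj : Function.Injective fun k : ℕ => -((k : ℤ) + 1) := fun i j h => by simpa using h
  have hpos : (uniformOn Set.univ : Measure Bool) {false} ≠ 0 := by
    rw [uniformOn_univ, Measure.count_singleton]
    simp
  filter_upwards [ae_exists_mem_infinitePi _ (.singleton false) hpos
    (Set.infinite_range_of_injective hinj)]
  rintro x ⟨_, ⟨k, rfl⟩, hk⟩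
  exact ⟨k, hk⟩

end CoinTosses

section FreeGroupActions

theorem measurePreserving_lift {α Z : Type*} [MeasurableSpace Z] {μ : Measure Z}
    {e : α → Z ≃ᵐ Z} (he : ∀ s, MeasurePreserving (e s) μ μ) (g : FreeGroup α) :
    MeasurePreserving (FreeGroup.lift (fun s => (e s).toEquiv : α → Equiv.Perm Z) g) μ μ := by
  induction g using FreeGroup.induction_on with
  | C1 => rw [map_one]; exact .id μ
  | of s => rw [FreeGroup.lift_apply_of]; exact he s
  | inv_of s _ => rw [map_inv, FreeGroup.lift_apply_of]; exact (he s).symm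
  | mul g h hg hh => rw [map_mul]; exact hg.comp hh

open FreeGroup (of)
open scoped commutatorElement

theorem isMeasureFreeFactor_zpowers_commutator_mul {α : Type} [Countable α] {a b : α} (hab : a ≠ b)
    {w : FreeGroup α} (hw : w ∈ Subgroup.closure (of '' {s | s ≠ a ∧ s ≠ b})) :
    IsMeasureFreeFactor (Subgroup.zpowers (⁅of a, of b⁆ * w)) := by
  classical
  let e : α → (ℤ → Bool) ≃ᵐ (ℤ → Bool) := fun s =>
    if s = a then flipZero else if s = b then shiftRight else .refl _
  have hmp := measurePreserving_lift (μ := coinSequence) (e := e) fun s => by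
    simp only [e]
    split_ifs
    exacts [measurePreserving_flipZero, measurePreserving_shiftRight, .id _]
  let : MulAction (FreeGroup α) (ℤ → Bool) :=
    .compHom _ (FreeGroup.lift (fun s => (e s).toEquiv : α → Equiv.Perm (ℤ → Bool)))
  have : MeasurableConstSMul (FreeGroup α) (ℤ → Bool) := ⟨fun g => (hmp g).measurable⟩
  have : SMulInvariantMeasure (FreeGroup α) (ℤ → Bool) coinSequence :=
    ⟨fun g _ hs => (hmp g).measure_preimage hs.nullMeasurableSet⟩
  have hof (s : α) (x : ℤ → Bool) : of s • x = e s x :=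
    congr_arg (· x) (FreeGroup.lift_apply_of (f := fun s => (e s).toEquiv))
  have hD : MeasurableSet {x : ℤ → Bool | x 0 = false} :=
    measurableSet_eq_fun (measurable_pi_apply 0) measurable_const
  refine isMeasureFreeFactor_zpowers_of_rank hab hw coinSequence hD (ℓ := coinRank) ?_ ?_
  · simp only [hof, e, if_pos]
    exact .of_forall fun _ => coinRank_flipZero_lt
  · simp only [hof, e, if_neg hab.symm, if_pos, Set.mem_ofPred_eq, Bool.not_eq_false]
    filter_upwards [ae_exists_eq_false] with x hx h using coinRank_shiftRight_lt h hx

theorem mainTheorem2_general {α : Type} [Countable α] {p : ℕ} {a b : Fin p → α}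
    (hab : Function.Injective (Sum.elim a b)) :
    IsMeasureFreeFactor
      (Subgroup.zpowers (List.ofFn fun i => ⁅of (a i), of (b i)⁆).prod) := by
  cases p with
  | zero => simpa only [List.ofFn_zero, List.prod_nil, Subgroup.zpowers_one_eq_bot] using
      isMeasureFreeFactor_bot
  | succ p =>
    rw [List.ofFn_succ, List.prod_cons]
    refine isMeasureFreeFactor_zpowers_commutator_mul (hab.ne Sum.inl_ne_inr) ?_
    refine Subgroup.list_prod_mem _ fun x hx => ?_
    obtain ⟨i, rfl⟩ := List.mem_ofFn.1 hx
    have hmem (t : Fin (p + 1) ⊕ Fin (p + 1)) (hl : t ≠ .inl 0) (hr : t ≠ .inr 0) :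
        of (Sum.elim a b t) ∈ Subgroup.closure (of '' {s | s ≠ a 0 ∧ s ≠ b 0}) :=
      Subgroup.subset_closure (Set.mem_image_of_mem _ ⟨hab.ne hl, hab.ne hr⟩)
    have ha := hmem (.inl i.succ) (by simp) (by simp)
    have hb := hmem (.inr i.succ) (by simp) (by simp)
    exact mul_mem (mul_mem (mul_mem ha hb) (inv_mem ha)) (inv_mem hb)

end FreeGroupActions

theorem mainTheorem2 (p : ℕ) :
    IsMeasureFreeFactor (Subgroup.zpowers (prodCommutators p)) :=
  mainTheorem2_general (a := Sum.inl) (b := Sum.inr) (Sum.elim_inl_inr ▸ Function.injective_id)
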